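/- Let $F\colon\mathbb R^n\to\mathbb R^m$ be twice continuously differentiable, let $D_1,\ldots,D_r\subset\mathbb R^m$ be polyhedral sets (intersections of finitely many closed half spaces), and put $D:=\bigcup_{i=1}^rD_i$ and $X:=\{x\in\mathbb R^n : F(x)\in D\}$. For sequences of real numbers, $t_k\downarrow 0$ means $t_k>0$ for all $k$ and $t_k\to 0$. For a set $A$ in a Euclidean space and $x\in A$, let $$\mathcal T_A(x):=\{d : \exists\, t_k\downarrow 0,\ \exists\, d_k\to d \text{ with } x+t_kd_k\in A\ \forall k\}$$ be the tangent cone and $\widehat{\mathcal N}_A(x):=\{\eta : \eta\cdot d\le 0\ \ \forall d\in\mathcal T_A(x)\}$ the Fréchet normal cone (both are empty if $x\notin A$). For $d\in\mathcal T_A(x)$, let $$\mathcal T^2_A(x;d):=\{h : \exists\, t_k\downarrow 0,\ \exists\, h_k\to h\text{ with } x+t_kd+\tfrac12t_k^2h_k\in A\ \forall k\},$$ $$\mathcal T^{\flat,2}_A(x;d):=\{h : \forall\, t_k\downarrow 0\ \ \exists\, h_k\to h\text{ with } x+t_kd+\tfrac12t_k^2h_k\in A\ \forall k\}$$ be the outer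 and the inner second-order tangent set; $A$ is called parabolically derivable at $x$ in direction $d$ if $\mathcal T^{\flat,2}_A(x;d)=\mathcal T^{2}_A(x;d)$. Write $\nabla F(x)$ for the Jacobian and $\nabla^2F(x)[d,d]$ for the vector with the components $d^\top\nabla^2F_j(x)d$, $j=1,\ldots,m$. Let $\bar x\in X$ be a point at which MPDC-LICQ holds, that is, with $I(\bar x):=\{i : F(\bar x)\in D_i\}$, $$\nabla F(\bar x)^\top\lambda=0,\quad \lambda\in\sum_{i\in I(\bar x)}\operatorname{span}\widehat{\mathcal N}_{D_i}(F(\bar x))\quad\Longrightarrow\quad\lambda=0.$$ Then, for each $d\in\mathcal T_X(\bar x)$, $$\mathcal T^2_X(\bar x;d)=\bigl\{h\in\mathbb R^n : \nabla F(\bar x)h+\nabla^2F(\bar x)[d,d]\in\mathcal T_{\mathcal T_D(F(\bar x))}(\nabla F(\bar x)d)\bigr\}.$$ Furthermore, $\mathcal T^2_X(\bar x;d)$ is nonempty, and $X$ is parabolically derivable at $\bar x$ in direction $d$. -/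

import Mathlib

open Filter Topology

noncomputable section

namespace MPDC

/-- `t k ↓ 0`: a sequence of positive reals that tends to zero. -/
def DownToZero (t : ℕ → ℝ) : Prop :=
  (∀ k, 0 < t k) ∧ Tendsto t atTop (𝓝 0)

/-- A polyhedral set: an intersection of finitely many closed half spaces. -/
def IsPolyhedral {m : ℕ} (Q : Set (EuclideanSpace ℝ (Fin m))) : Prop :=
  ∃ (N : ℕ) (a : Fin N → EuclideanSpace ℝ (Fin m)) (b : Fin N → ℝ),
    Q = ⋂ j, {y | inner ℝ (a j) y ≤ b j}

/-- The (Bouligand) tangent cone to `A` at `x`; it is empty if `x ∉ A`. -/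
def tangentCone {n : ℕ} (A : Set (EuclideanSpace ℝ (Fin n))) (x : EuclideanSpace ℝ (Fin n)) :
    Set (EuclideanSpace ℝ (Fin n)) :=
  {d | x ∈ A ∧ ∃ (t : ℕ → ℝ) (v : ℕ → EuclideanSpace ℝ (Fin n)),
    DownToZero t ∧ Tendsto v atTop (𝓝 d) ∧ ∀ k, x + t k • v k ∈ A}

/-- The Fréchet (regular) normal cone to `A` at `x`: the polar cone of the tangent cone;
it is empty if `x ∉ A`. -/
def frechetNormalCone {n : ℕ} (A : Set (EuclideanSpace ℝ (Fin n)))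
    (x : EuclideanSpace ℝ (Fin n)) : Set (EuclideanSpace ℝ (Fin n)) :=
  {η | x ∈ A ∧ ∀ d ∈ tangentCone A x, inner ℝ d η ≤ 0}

/-- The outer (Bouligand) second-order tangent set to `A` at `x` in direction `d`;
it is empty if `d` is not tangent to `A` at `x`. -/
def outerTangentSet₂ {n : ℕ} (A : Set (EuclideanSpace ℝ (Fin n)))
    (x d : EuclideanSpace ℝ (Fin n)) : Set (EuclideanSpace ℝ (Fin n)) :=
  {h | d ∈ tangentCone A x ∧ ∃ (t : ℕ → ℝ) (v : ℕ → EuclideanSpace ℝ (Fin n)),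
    DownToZero t ∧ Tendsto v atTop (𝓝 h) ∧
      ∀ k, x + t k • d + ((1 / 2 : ℝ) * t k ^ 2) • v k ∈ A}

/-- The inner (adjacent) second-order tangent set to `A` at `x` in direction `d`;
it is empty if `d` is not tangent to `A` at `x`. -/
def innerTangentSet₂ {n : ℕ} (A : Set (EuclideanSpace ℝ (Fin n)))
    (x d : EuclideanSpace ℝ (Fin n)) : Set (EuclideanSpace ℝ (Fin n)) :=
  {h | d ∈ tangentCone A x ∧ ∀ t : ℕ → ℝ, DownToZero t →
    ∃ v : ℕ → EuclideanSpace ℝ (Fin n), Tendsto v atTop (𝓝 h) ∧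
      ∀ k, x + t k • d + ((1 / 2 : ℝ) * t k ^ 2) • v k ∈ A}

/-- `A` is parabolically derivable at `x` in direction `d`. -/
def ParabolicallyDerivableAt {n : ℕ} (A : Set (EuclideanSpace ℝ (Fin n)))
    (x d : EuclideanSpace ℝ (Fin n)) : Prop :=
  innerTangentSet₂ A x d = outerTangentSet₂ A x d

/-- `∇²P(x)[d,h]`, the second derivative of `P` at `x` as a vector-valued bilinear form.
For a twice continuously differentiable `P` its `i`-th component is `dᵀ ∇²Pᵢ(x) h`. -/
def secondDeriv {n m : ℕ} (P : EuclideanSpace ℝ (Fin n) → EuclideanSpace ℝ (Fin m))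
    (x d h : EuclideanSpace ℝ (Fin n)) : EuclideanSpace ℝ (Fin m) :=
  fderiv ℝ (fderiv ℝ P) x d h

/-- The union `D = D₁ ∪ … ∪ D_r`. -/
def disjunctiveSet {m r : ℕ} (D : Fin r → Set (EuclideanSpace ℝ (Fin m))) :
    Set (EuclideanSpace ℝ (Fin m)) :=
  ⋃ i, D i

/-- The feasible set `X = {x | F(x) ∈ D₁ ∪ … ∪ D_r}`. -/
def feasibleSet {n m r : ℕ} (F : EuclideanSpace ℝ (Fin n) → EuclideanSpace ℝ (Fin m))
    (D : Fin r → Set (EuclideanSpace ℝ (Fin m))) : Set (EuclideanSpace ℝ (Fin n)) :=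
  {x | F x ∈ disjunctiveSet D}

/-- MPDC-LICQ at `x`: the only `lam` in the sum of the spans of the Fréchet normal cones to
those `D i` that contain `F x`, with `∇F(x)ᵀ lam = 0`, is `lam = 0`. -/
def LICQ {n m r : ℕ} (F : EuclideanSpace ℝ (Fin n) → EuclideanSpace ℝ (Fin m))
    (D : Fin r → Set (EuclideanSpace ℝ (Fin m))) (x : EuclideanSpace ℝ (Fin n)) : Prop :=
  ∀ lam : EuclideanSpace ℝ (Fin m),
    ContinuousLinearMap.adjoint (fderiv ℝ F x) lam = 0 →
    lam ∈ (⨆ (i : Fin r) (_ : F x ∈ D i), Submodule.span ℝ (frechetNormalCone (D i) (F x))) →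
    lam = 0

end MPDC

end

/-! Near a point, a finite union of polyhedral sets is exactly a translate of its tangent cone, and
this cone is again a finite union of polyhedral sets (`exists_tangentCone_pieces`). Expanding `F` to
second order along a parabola therefore gives the inclusion from left to right, without LICQ.

For the converse, let `S` be the sum of the spans of the normal cones. Moving along `Sᗮ` never
leaves the tangent cone of `D`, so only the projection `P` of `F` onto `S` has to be controlled.
LICQ says exactly that `P ∘ ∇F(x)` is surjective, so `P ∘ F` is metrically regular
(`exists_preimage_near`). Since `w = ∇F(x)h + ∇²F(x)[d,d]` is an iterated tangent, polyhedrality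
places `F(x) + t∇F(x)d + (t²/2)w` in `D` for all small `t`. The parabola through `h` misses this
target by `o(t²)`, and a correction of size `o(t²)` repairs the `S`-component. This works for every
sequence `t ↓ 0`, which gives the inner tangent set and hence parabolic derivability. Nonemptiness
also follows from surjectivity: `h` can be chosen with `w ∈ Sᗮ`. -/

namespace MPDC

/-! ### Local conic structure of polyhedral sets and their finite unions. -/

section Cones

variable {n m r : ℕ}

theorem IsPolyhedral.isClosed {Q : Set (EuclideanSpace ℝ (Fin m))} (hQ : IsPolyhedral Q) :
    IsClosed Q := by
  obtain ⟨N, a, b, rfl⟩ := hQ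
  exact isClosed_iInter fun j => isClosed_le (by fun_prop) continuous_const

theorem isPolyhedral_empty : IsPolyhedral (∅ : Set (EuclideanSpace ℝ (Fin m))) := by
  refine ⟨1, fun _ => 0, fun _ => -1, ?_⟩
  ext z
  simp only [inner_zero_left, Set.mem_empty_iff_false, Set.mem_iInter, Set.mem_ofPred_eq,
    false_iff, not_forall]
  exact ⟨0, by norm_num⟩

theorem isClosed_disjunctiveSet {D : Fin r → Set (EuclideanSpace ℝ (Fin m))}
    (hD : ∀ i, IsPolyhedral (D i)) : IsClosed (disjunctiveSet D) :=
  isClosed_iUnion_of_finite fun i => (hD i).isClosed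

theorem DownToZero.shift {t : ℕ → ℝ} (ht : DownToZero t) (N : ℕ) :
    DownToZero fun k => t (k + N) :=
  ⟨fun _ => ht.1 _, (tendsto_add_atTop_iff_nat N).2 ht.2⟩

theorem downToZero_one_div : DownToZero fun k : ℕ => 1 / ((k : ℝ) + 1) :=
  ⟨fun k => by positivity, tendsto_one_div_add_atTop_nhds_zero_nat⟩

/-- In the definition of the tangent cone it is enough that almost all points lie in the set. -/
theorem mem_tangentCone_of_eventually {A : Set (EuclideanSpace ℝ (Fin n))}
    {x d : EuclideanSpace ℝ (Fin n)} (hx : x ∈ A) {t : ℕ → ℝ} (ht : DownToZero t)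
    {v : ℕ → EuclideanSpace ℝ (Fin n)} (hv : Tendsto v atTop (𝓝 d))
    (h : ∀ᶠ k in atTop, x + t k • v k ∈ A) : d ∈ tangentCone A x := by
  obtain ⟨N, hN⟩ := eventually_atTop.1 h
  exact ⟨hx, fun k => t (k + N), fun k => v (k + N), ht.shift N,
    (tendsto_add_atTop_iff_nat N).2 hv, fun k => hN _ (Nat.le_add_left _ _)⟩

/-- A set that agrees near `x` with the translate of a closed cone has this cone as its
tangent cone. -/
theorem tangentCone_eq_of_eventually {A C : Set (EuclideanSpace ℝ (Fin n))}
    {x : EuclideanSpace ℝ (Fin n)} (hx : x ∈ A) (hC : IsClosed C)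
    (hcone : ∀ c : ℝ, 0 < c → ∀ z ∈ C, c • z ∈ C)
    (h : ∀ᶠ z in 𝓝 (0 : EuclideanSpace ℝ (Fin n)), x + z ∈ A ↔ z ∈ C) :
    tangentCone A x = C := by
  ext d
  constructor
  · rintro ⟨-, t, v, ht, hv, hA⟩
    have h0 : Tendsto (fun k => t k • v k) atTop (𝓝 0) := by simpa using ht.2.smul hv
    refine hC.mem_of_tendsto hv ((h0.eventually h).mono fun k hk => ?_)
    have := hcone (t k)⁻¹ (inv_pos.2 (ht.1 k)) _ (hk.1 (hA k))
    rwa [smul_smul, inv_mul_cancel₀ (ht.1 k).ne', one_smul] at this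
  · intro hd
    refine mem_tangentCone_of_eventually hx downToZero_one_div tendsto_const_nhds ?_
    have h0 : Tendsto (fun k : ℕ => (1 / ((k : ℝ) + 1)) • d) atTop (𝓝 0) := by
      simpa using downToZero_one_div.2.smul_const d
    exact (h0.eventually h).mono fun k hk => hk.2 (hcone _ (downToZero_one_div.1 k) _ hd)

theorem mem_frechetNormalCone_of_active {Q : Set (EuclideanSpace ℝ (Fin m))}
    {y a : EuclideanSpace ℝ (Fin m)} (hy : y ∈ Q) (ha : ∀ z ∈ Q, inner ℝ a z ≤ inner ℝ a y) :
    a ∈ frechetNormalCone Q y := by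
  refine ⟨hy, ?_⟩
  rintro d ⟨-, t, v, ht, hv, hQ⟩
  refine le_of_tendsto' (hv.inner tendsto_const_nhds) fun k => ?_
  have := ha _ (hQ k)
  rw [inner_add_right, inner_smul_right, add_le_iff_nonpos_right] at this
  rw [real_inner_comm]
  exact nonpos_of_mul_nonpos_right this (ht.1 k)

/-- Near each point, a polyhedral set is the translate of a polyhedral cone, which is invariant
under translations orthogonal to the normal cone. -/
theorem IsPolyhedral.exists_local_cone {Q : Set (EuclideanSpace ℝ (Fin m))}
    (hQ : IsPolyhedral Q) (y : EuclideanSpace ℝ (Fin m)) :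
    ∃ C : Set (EuclideanSpace ℝ (Fin m)), IsPolyhedral C ∧
      (∀ c : ℝ, 0 < c → ∀ z ∈ C, c • z ∈ C) ∧
      (∀ᶠ z in 𝓝 (0 : EuclideanSpace ℝ (Fin m)), y + z ∈ Q ↔ z ∈ C) ∧
      ∀ z ∈ C, y ∈ Q ∧ ∀ l, (∀ a ∈ frechetNormalCone Q y, inner ℝ a l = 0) → z + l ∈ C := by
  have htend : Tendsto (fun z => y + z) (𝓝 0) (𝓝 y) := by
    simpa using (continuous_const_add y).tendsto 0
  by_cases hy : y ∈ Q
  swap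
  · refine ⟨∅, isPolyhedral_empty, by simp, ?_, by simp⟩
    filter_upwards [htend.eventually (hQ.isClosed.isOpen_compl.mem_nhds hy)] with z hz
    simpa using hz
  obtain ⟨N, a, b, rfl⟩ := hQ
  have hyb : ∀ j, inner ℝ (a j) y ≤ b j := by simpa using hy
  classical
  -- Inactive constraints are replaced by `0 ≤ 0`, which keeps the index type `Fin N`; near `y` they
  -- hold strictly anyway.
  refine ⟨⋂ j, {z | inner ℝ (if inner ℝ (a j) y = b j then a j else 0) z ≤ 0},
    ⟨N, _, fun _ => 0, rfl⟩, ?_, ?_, ?_⟩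
  · intro c hc z hz
    simp only [Set.mem_iInter, Set.mem_ofPred_eq] at hz ⊢
    intro j
    rw [inner_smul_right]
    exact mul_nonpos_of_nonneg_of_nonpos hc.le (hz j)
  · have hev : ∀ᶠ z in 𝓝 (0 : EuclideanSpace ℝ (Fin m)), ∀ j,
        inner ℝ (a j) y ≠ b j → inner ℝ (a j) (y + z) < b j := by
      refine eventually_all.2 fun j => ?_
      by_cases hj : inner ℝ (a j) y = b j
      · simp [hj]
      · have hlt := lt_of_le_of_ne (hyb j) hj
        filter_upwards [htend.eventually
          ((by fun_prop : Continuous fun z => inner ℝ (a j) z).continuousAt.eventually_lt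
            continuousAt_const hlt)] with z hz _ using hz
    filter_upwards [hev] with z hz
    simp only [Set.mem_iInter, Set.mem_ofPred_eq]
    refine forall_congr' fun j => ?_
    by_cases hj : inner ℝ (a j) y = b j
    · rw [if_pos hj, inner_add_right, hj, add_le_iff_nonpos_right]
    · simp [hj, (hz j hj).le]
  · refine fun z hz => ⟨hy, fun l hl => ?_⟩
    simp only [Set.mem_iInter, Set.mem_ofPred_eq] at hz ⊢
    intro j
    have := hz j
    split_ifs at this ⊢ with hj
    · rw [inner_add_right, hl (a j), add_zero]
      · exact this
      · refine mem_frechetNormalCone_of_active hy fun z hz => ?_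
        rw [hj]
        exact Set.mem_iInter.1 hz j
    · simp

/-- The tangent cone to a finite union of polyhedral sets is again such a union, it describes the
set near the base point, and it is invariant under translations orthogonal to all normal cones. -/
theorem exists_tangentCone_pieces {D : Fin r → Set (EuclideanSpace ℝ (Fin m))}
    (hD : ∀ i, IsPolyhedral (D i)) {y : EuclideanSpace ℝ (Fin m)} (hy : y ∈ disjunctiveSet D) :
    ∃ C : Fin r → Set (EuclideanSpace ℝ (Fin m)), (∀ i, IsPolyhedral (C i)) ∧
      tangentCone (disjunctiveSet D) y = disjunctiveSet C ∧
      (∀ c : ℝ, 0 < c → ∀ z ∈ disjunctiveSet C, c • z ∈ disjunctiveSet C) ∧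
      (∀ᶠ z in 𝓝 (0 : EuclideanSpace ℝ (Fin m)),
        y + z ∈ disjunctiveSet D ↔ z ∈ disjunctiveSet C) ∧
      ∀ z ∈ disjunctiveSet C,
        ∀ l ∈ (⨆ (i : Fin r) (_ : y ∈ D i), Submodule.span ℝ (frechetNormalCone (D i) y))ᗮ,
          z + l ∈ disjunctiveSet C := by
  -- Pieces that do not contain `y` contribute an empty cone, so all indices can be treated alike.
  choose C hC hcone hloc htrans using fun i => (hD i).exists_local_cone y
  have hcone' : ∀ c : ℝ, 0 < c → ∀ z ∈ disjunctiveSet C, c • z ∈ disjunctiveSet C := by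
    intro c hc z hz
    obtain ⟨i, hi⟩ := Set.mem_iUnion.1 hz
    exact Set.mem_iUnion.2 ⟨i, hcone i c hc z hi⟩
  have hloc' : ∀ᶠ z in 𝓝 (0 : EuclideanSpace ℝ (Fin m)),
      y + z ∈ disjunctiveSet D ↔ z ∈ disjunctiveSet C := by
    filter_upwards [eventually_all.2 hloc] with z hz
    simp only [disjunctiveSet, Set.mem_iUnion, hz]
  refine ⟨C, hC, tangentCone_eq_of_eventually hy (isClosed_disjunctiveSet hC) hcone' hloc',
    hcone', hloc', fun z hz l hl => ?_⟩
  obtain ⟨i, hi⟩ := Set.mem_iUnion.1 hz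
  obtain ⟨hyi, ht⟩ := htrans i z hi
  refine Set.mem_iUnion.2 ⟨i, ht l fun a ha => ?_⟩
  exact hl a (le_iSup₂_of_le (f := fun (i : Fin r) (_ : y ∈ D i) =>
    Submodule.span ℝ (frechetNormalCone (D i) y)) i hyi le_rfl (Submodule.subset_span ha))

end Cones

end MPDC

namespace MPDC

/-! ### Second-order expansions and metric regularity. -/

section Calculus

variable {E G : Type*} [NormedAddCommGroup E] [NormedSpace ℝ E] [NormedAddCommGroup G]
  [NormedSpace ℝ G]

/-- Second-order Taylor expansion along a ray. -/
theorem isLittleO_taylor_ray {F : E → G} (hF : ContDiff ℝ 2 F) (x d : E) :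
    (fun s : ℝ => F (x + s • d) - F x - s • fderiv ℝ F x d
      - (s ^ 2 / 2) • fderiv ℝ (fderiv ℝ F) x d d) =o[𝓝[>] 0] fun s => s ^ 2 := by
  set A := fderiv ℝ F x
  set H := fderiv ℝ (fderiv ℝ F) x
  have hline : ∀ s : ℝ, HasDerivAt (fun s : ℝ => x + s • d) d s := fun s => by
    simpa using ((hasDerivAt_id s).smul_const d).const_add x
  have hF' : ∀ p, HasFDerivAt F (fderiv ℝ F p) p := fun p =>
    (hF.differentiable (by norm_num) p).hasFDerivAt
  have hderiv : ∀ s : ℝ, HasDerivAt (fun s : ℝ => F (x + s • d) - F x - s • A d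
      - (s ^ 2 / 2) • H d d) (fderiv ℝ F (x + s • d) d - A d - s • H d d) s := fun s => by
    have h1 := (hF' (x + s • d)).comp_hasDerivAt s (hline s)
    have h2 : HasDerivAt (fun s : ℝ => s • A d) (A d) s := by
      simpa using (hasDerivAt_id s).smul_const (A d)
    have h3 : HasDerivAt (fun s : ℝ => (s ^ 2 / 2) • H d d) (s • H d d) s := by
      simpa using ((hasDerivAt_pow 2 s).div_const 2).smul_const (H d d)
    exact ((h1.sub_const (F x)).sub h2).sub h3
  have hH : HasFDerivAt (fderiv ℝ F) H x :=
    ((hF.fderiv_right (m := 1) (by norm_num)).differentiable (by norm_num) x).hasFDerivAt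
  have hsmall : (fun s : ℝ => fderiv ℝ F (x + s • d) d - A d - s • H d d) =o[𝓝 0]
      fun s => s := by
    have h0 : HasFDerivAt (fderiv ℝ F) H (x + (0 : ℝ) • d) := by simpa using hH
    have h1 : HasDerivAt (fun s : ℝ => fderiv ℝ F (x + s • d)) (H d) 0 :=
      h0.comp_hasDerivAt (0 : ℝ) (hline 0)
    have h2 : HasDerivAt (fun s : ℝ => fderiv ℝ F (x + s • d) d) (H d d) 0 := by
      simpa using h1.clm_apply (hasDerivAt_const (0 : ℝ) d)
    simpa [A] using h2.isLittleO
  refine Asymptotics.isLittleO_iff.2 fun ε hε => ?_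
  obtain ⟨δ, hδ, hball⟩ := Metric.eventually_nhds_iff.1 (Asymptotics.isLittleO_iff.1 hsmall hε)
  filter_upwards [Ioo_mem_nhdsGT hδ] with s hs
  -- The remainder vanishes at `0` and its derivative is at most `ε * s` on `[0, s)`, so the
  -- remainder at `s` is at most `ε * s ^ 2`.
  have key := norm_image_sub_le_of_norm_deriv_le_segment' (a := 0) (b := s) (C := ε * s)
    (fun u _ => (hderiv u).hasDerivWithinAt) (fun u hu => ?_) s (Set.right_mem_Icc.2 hs.1.le)
  · simpa [pow_two, abs_of_pos hs.1, mul_assoc] using key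
  · refine (hball ?_).trans ?_
    · rw [dist_zero_right, Real.norm_eq_abs, abs_of_nonneg hu.1]
      exact hu.2.trans hs.2
    · rw [Real.norm_eq_abs, abs_of_nonneg hu.1]
      exact mul_le_mul_of_nonneg_left hu.2.le hε.le

theorem DownToZero.tendsto_nhdsGT {t : ℕ → ℝ} (ht : DownToZero t) :
    Tendsto t atTop (𝓝[>] 0) :=
  tendsto_nhdsWithin_iff.2 ⟨ht.2, Eventually.of_forall ht.1⟩

/-- Second-order Taylor expansion along a parabolic sequence. -/
theorem tendsto_taylor_parabola {F : E → G} (hF : ContDiff ℝ 2 F) (x d h : E) {t : ℕ → ℝ}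
    (ht : DownToZero t) {v : ℕ → E} (hv : Tendsto v atTop (𝓝 h)) :
    Tendsto (fun k => (2 / t k ^ 2) • (F (x + t k • d + ((1 / 2 : ℝ) * t k ^ 2) • v k) - F x
      - t k • fderiv ℝ F x d)) atTop
      (𝓝 (fderiv ℝ F x h + fderiv ℝ (fderiv ℝ F) x d d)) := by
  set A := fderiv ℝ F x
  set B := fderiv ℝ (fderiv ℝ F) x d d
  set u : ℕ → E := fun k => ((1 / 2 : ℝ) * t k ^ 2) • v k with hu_def
  have hray : (fun k => F (x + t k • d) - F x - t k • A d - (t k ^ 2 / 2) • B)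
      =o[atTop] fun k => t k ^ 2 := (isLittleO_taylor_ray hF x d).comp_tendsto ht.tendsto_nhdsGT
  have hp : Tendsto (fun k => x + t k • d) atTop (𝓝 x) := by
    simpa using (ht.2.smul_const d).const_add x
  have hu : Tendsto u atTop (𝓝 0) := by
    have := ((ht.2.pow 2).const_mul (1 / 2)).smul hv
    rwa [zero_pow two_ne_zero, mul_zero, zero_smul] at this
  have hpu : Tendsto (fun k => x + t k • d + u k) atTop (𝓝 x) := by simpa using hp.add hu
  have hO : u =O[atTop] fun k => t k ^ 2 := by
    simpa [hu_def] using ((Asymptotics.isBigO_refl (fun k => t k ^ 2) atTop).const_mul_left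
      (1 / 2 : ℝ)).smul (hv.isBigO_one ℝ)
  -- Both points move with `k`, so strict differentiability is needed; their difference `u k` is
  -- `O(t²)`.
  have hstrict : (fun k => F (x + t k • d + u k) - F (x + t k • d) - A (u k))
      =o[atTop] fun k => t k ^ 2 := by
    have := ((hF.contDiffAt (x := x)).hasStrictFDerivAt (by norm_num)).isLittleO.comp_tendsto
      (hpu.prodMk_nhds hp)
    simp only [Function.comp_def, add_sub_cancel_left] at this
    exact this.trans_isBigO hO
  have hlim := ((hray.add hstrict).tendsto_inv_smul_nhds_zero.const_smul (2 : ℝ)).add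
    (((A.continuous.tendsto h).comp hv).add_const B)
  rw [smul_zero, zero_add] at hlim
  refine hlim.congr fun k => ?_
  have h0 : t k ≠ 0 := (ht.1 k).ne'
  simp only [Function.comp_apply, hu_def, map_smul]
  match_scalars <;> field_simp <;> norm_num

/-- Metric regularity at a point with surjective strict derivative. -/
theorem exists_preimage_near [CompleteSpace E] [CompleteSpace G] {f : E → G} {f' : E →L[ℝ] G}
    {a : E} (hf : HasStrictFDerivAt f f' a) (hsurj : f'.range = ⊤) :
    ∃ c : ℝ, ∀ᶠ p in 𝓝 (a, f a), ∃ q, f q = p.2 ∧ ‖q - p.1‖ ≤ c * ‖f p.1 - p.2‖ := by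
  let R := f'.nonlinearRightInverseOfSurjective hsurj
  have hR : 0 < R.nnnorm := f'.nonlinearRightInverseOfSurjective_nnnorm_pos hsurj
  have hpos : 0 < R.nnnorm⁻¹ / 2 := by positivity
  obtain ⟨s, hs, happ⟩ := hf.approximates_deriv_on_nhds (Or.inr hpos)
  obtain ⟨ρ, hρ, hball⟩ := Metric.mem_nhds_iff.1 hs
  -- Approximation with constant `‖R‖⁻¹ / 2` makes the image of a ball of radius `ε` cover a ball of
  -- radius `ε / (2‖R‖)`.
  set c : ℝ := 2 * R.nnnorm with hc
  have hR' : (0 : ℝ) < R.nnnorm := hR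
  refine ⟨c, ?_⟩
  have h1 : ∀ᶠ p : E × G in 𝓝 (a, f a), p.1 ∈ Metric.ball a (ρ / 2) :=
    continuousAt_fst.eventually (Metric.ball_mem_nhds _ (half_pos hρ))
  have hfc : ContinuousAt (fun p : E × G => c * ‖f p.1 - p.2‖) (a, f a) :=
    continuousAt_const.mul
      (((ContinuousAt.comp (x := (a, f a)) hf.continuousAt continuousAt_fst).sub
        continuousAt_snd).norm)
  have h2 : ∀ᶠ p : E × G in 𝓝 (a, f a), c * ‖f p.1 - p.2‖ < ρ / 2 :=
    hfc.eventually_lt continuousAt_const (by simpa using half_pos hρ)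
  filter_upwards [h1, h2] with p hp1 hp2
  have hε : 0 ≤ c * ‖f p.1 - p.2‖ := by positivity
  have hsub : Metric.closedBall p.1 (c * ‖f p.1 - p.2‖) ⊆ s := by
    refine (fun q hq => hball ?_)
    rw [Metric.mem_ball] at hp1 ⊢
    rw [Metric.mem_closedBall] at hq
    linarith [dist_triangle q p.1 a]
  obtain ⟨q, hq, hfq⟩ := happ.surjOn_closedBall_of_nonlinearRightInverse R hε hsub
    (show p.2 ∈ _ by
      rw [Metric.mem_closedBall, dist_comm, dist_eq_norm]
      refine le_of_eq ?_
      push_cast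
      rw [hc]
      field_simp
      ring)
  exact ⟨q, hfq, by rwa [← dist_eq_norm]⟩

end Calculus

/-- The projection of the derivative onto a subspace that meets the kernel of the adjoint
trivially is surjective. -/
theorem range_orthogonalProjectionOnto_comp_eq_top {E G : Type*} [NormedAddCommGroup E]
    [InnerProductSpace ℝ E] [FiniteDimensional ℝ E] [NormedAddCommGroup G]
    [InnerProductSpace ℝ G] [FiniteDimensional ℝ G] (A : E →L[ℝ] G) (S : Submodule ℝ G)
    (h : ∀ l ∈ S, ContinuousLinearMap.adjoint A l = 0 → l = 0) :
    (S.orthogonalProjectionOnto ∘L A).range = ⊤ := by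
  rw [← Submodule.orthogonal_eq_bot_iff, Submodule.eq_bot_iff]
  intro s hs
  -- For `s ∈ S`, orthogonality to the range of the projected map means that the adjoint of `A`
  -- kills `s`.
  have h0 : ∀ u, inner ℝ u (ContinuousLinearMap.adjoint A (s : G)) = 0 := fun u => by
    rw [ContinuousLinearMap.adjoint_inner_right]
    have := hs _ ⟨u, rfl⟩
    simpa using this
  exact Subtype.ext (h s s.2 (by simpa using h0 (ContinuousLinearMap.adjoint A (s : G))))

end MPDC

namespace MPDC

/-! ### The two inclusions and nonemptiness. -/

section TangentSets

variable {n m r : ℕ} {F : EuclideanSpace ℝ (Fin n) → EuclideanSpace ℝ (Fin m)}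
  {D : Fin r → Set (EuclideanSpace ℝ (Fin m))} {x d h : EuclideanSpace ℝ (Fin n)}

theorem DownToZero.half {t : ℕ → ℝ} (ht : DownToZero t) : DownToZero fun k => t k / 2 :=
  ⟨fun k => half_pos (ht.1 k), by simpa using ht.2.div_const 2⟩

/-- The derivative maps tangent vectors of the feasible set to tangent vectors of `D`. -/
theorem fderiv_mem_tangentCone (hF : DifferentiableAt ℝ F x)
    (hd : d ∈ tangentCone (feasibleSet F D) x) :
    fderiv ℝ F x d ∈ tangentCone (disjunctiveSet D) (F x) := by
  obtain ⟨hx, t, v, ht, hv, hX⟩ := hd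
  refine ⟨hx, t, fun k => (t k)⁻¹ • (F (x + t k • v k) - F x), ht, ?_, fun k => ?_⟩
  · have h0 : Tendsto (fun k => x + t k • v k) atTop (𝓝 x) := by
      simpa using (ht.2.smul hv).const_add x
    have hO : (fun k => t k • v k) =O[atTop] t := by
      simpa using (Asymptotics.isBigO_refl t atTop).smul (hv.isBigO_one ℝ)
    have hlit : (fun k => F (x + t k • v k) - F x - fderiv ℝ F x (t k • v k)) =o[atTop] t := by
      have := hF.hasFDerivAt.isLittleO.comp_tendsto h0
      simp only [Function.comp_def, add_sub_cancel_left] at this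
      exact this.trans_isBigO hO
    have hlim := hlit.tendsto_inv_smul_nhds_zero.add
      (((fderiv ℝ F x).continuous.tendsto d).comp hv)
    rw [zero_add] at hlim
    refine hlim.congr fun k => ?_
    rw [Function.comp_apply, map_smul, smul_sub _ _ (t k • _), smul_smul,
      inv_mul_cancel₀ (ht.1 k).ne', one_smul, sub_add_cancel]
  · rw [smul_smul, mul_inv_cancel₀ (ht.1 k).ne', one_smul, add_sub_cancel]
    exact hX k

/-- Necessary condition for outer second-order tangents of the feasible set. -/
theorem mem_tangentCone_of_mem_outerTangentSet₂ (hF : ContDiff ℝ 2 F)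
    (hD : ∀ i, IsPolyhedral (D i)) (hh : h ∈ outerTangentSet₂ (feasibleSet F D) x d) :
    fderiv ℝ F x h + secondDeriv F x d d ∈
      tangentCone (tangentCone (disjunctiveSet D) (F x)) (fderiv ℝ F x d) := by
  obtain ⟨hd, t, v, ht, hv, hX⟩ := hh
  have hAd := fderiv_mem_tangentCone (hF.differentiable (by norm_num) x) hd
  have hw := tendsto_taylor_parabola hF x d h ht hv
  obtain ⟨C, -, hCeq, hcone, hloc, -⟩ := exists_tangentCone_pieces hD hd.1
  -- The step size is `t / 2` because `(F(p) - F(x)) / t` equals `∇F(x)d` plus `t / 2` times the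
  -- rescaled Taylor difference in `hw`.
  refine mem_tangentCone_of_eventually hAd ht.half hw ?_
  rw [hCeq]
  have hp : Tendsto (fun k => x + t k • d + ((1 / 2 : ℝ) * t k ^ 2) • v k) atTop (𝓝 x) := by
    have := ((ht.2.smul_const d).const_add x).add (((ht.2.pow 2).const_mul (1 / 2)).smul hv)
    simpa only [zero_pow two_ne_zero, mul_zero, zero_smul, add_zero] using this
  have hz : Tendsto (fun k => F (x + t k • d + ((1 / 2 : ℝ) * t k ^ 2) • v k) - F x) atTop
      (𝓝 0) := by
    simpa using ((hF.continuous.tendsto x).comp hp).sub_const (F x)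
  filter_upwards [hz.eventually hloc] with k hk
  rw [add_sub_cancel] at hk
  have hmem := hcone (t k)⁻¹ (inv_pos.2 (ht.1 k)) _ (hk.1 (hX k))
  have h0 : t k ≠ 0 := (ht.1 k).ne'
  convert hmem using 1
  match_scalars <;> field_simp; ring

/-- Under LICQ the necessary condition is sufficient, even for inner second-order tangents. -/
theorem mem_innerTangentSet₂_of_mem_tangentCone (hF : ContDiff ℝ 2 F)
    (hD : ∀ i, IsPolyhedral (D i)) (hLICQ : LICQ F D x)
    (hd : d ∈ tangentCone (feasibleSet F D) x)
    (hh : fderiv ℝ F x h + secondDeriv F x d d ∈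
      tangentCone (tangentCone (disjunctiveSet D) (F x)) (fderiv ℝ F x d)) :
    h ∈ innerTangentSet₂ (feasibleSet F D) x d := by
  refine ⟨hd, fun t ht => ?_⟩
  set S := ⨆ (i : Fin r) (_ : F x ∈ D i), Submodule.span ℝ (frechetNormalCone (D i) (F x))
  set A := fderiv ℝ F x 
  set w := A h + secondDeriv F x d d 
  obtain ⟨C, hC, hCeq, hcone, hloc, htrans⟩ := exists_tangentCone_pieces hD hd.1
  rw [hCeq] at hh
  -- The tangent cone is itself a finite union of polyhedral sets, so the local description applies
  -- a second time, now at `A d`.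
  obtain ⟨K, -, hKeq, hKcone, hKloc, -⟩ := exists_tangentCone_pieces hC hh.1
  rw [hKeq] at hh
  let P := S.orthogonalProjectionOnto
  have hsurj : (P ∘L A).range = ⊤ :=
    range_orthogonalProjectionOnto_comp_eq_top A S fun l hl hl0 => hLICQ l hl0 hl
  have hstrict : HasStrictFDerivAt (fun p => P (F p)) (P ∘L A) x :=
    P.hasStrictFDerivAt.comp x ((hF.contDiffAt (x := x)).hasStrictFDerivAt (by norm_num))
  obtain ⟨c, hreg⟩ := exists_preimage_near hstrict hsurj
  set p : ℕ → EuclideanSpace ℝ (Fin n) := fun k => x + t k • d + ((1 / 2 : ℝ) * t k ^ 2) • h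
    with hp_def
  set y : ℕ → EuclideanSpace ℝ (Fin m) :=
    fun k => F x + t k • (A d + (t k / 2) • w) with hy_def
  set e : ℕ → EuclideanSpace ℝ (Fin m) :=
    fun k => (2 / t k ^ 2) • (F (p k) - F x - t k • A d) - w with he_def
  have he : Tendsto e atTop (𝓝 0) := by
    have := (tendsto_taylor_parabola hF x d h ht (tendsto_const_nhds (x := h))).sub_const w
    rwa [show A h + fderiv ℝ (fderiv ℝ F) x d d - w = 0 from sub_self w] at this
  have hFp : ∀ k, F (p k) - y k = (t k ^ 2 / 2) • e k := fun k => by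
    have h0 : t k ≠ 0 := (ht.1 k).ne'
    simp only [he_def, hy_def]
    match_scalars <;> field_simp
  have hp : Tendsto p atTop (𝓝 x) := by
    have := ((ht.2.smul_const d).const_add x).add
      (((ht.2.pow 2).const_mul (1 / 2)).smul_const h)
    simpa only [zero_pow two_ne_zero, mul_zero, zero_smul, add_zero] using this
  have hy : Tendsto y atTop (𝓝 (F x)) := by
    have := (ht.2.smul (((ht.half.2).smul_const w).const_add (A d))).const_add (F x)
    simpa only [zero_smul, add_zero] using this
  -- Only the `S`-component of the target `y k` is hit exactly; the remaining error lies in `Sᗮ` and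
  -- is harmless.
  have hex : ∀ᶠ k in atTop, ∃ q, F q - y k ∈ Sᗮ ∧ ‖q - p k‖ ≤ c * ‖P (F (p k) - y k)‖ := by
    filter_upwards [(hp.prodMk_nhds ((P.continuous.tendsto (F x)).comp hy)).eventually hreg]
      with k ⟨q, hq, hqp⟩
    refine ⟨q, ?_, by simpa using hqp⟩
    rw [← Submodule.orthogonalProjectionOnto_eq_zero_iff, map_sub, sub_eq_zero]
    exact hq
  obtain ⟨q, hq⟩ := hex.choice
  set u : ℕ → EuclideanSpace ℝ (Fin n) := fun k => (2 / t k ^ 2) • (q k - p k) with hu_def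
  have hu : Tendsto u atTop (𝓝 0) := by
    have hlim : Tendsto (fun k => c * ‖P (e k)‖) atTop (𝓝 0) := by
      simpa using (((P.continuous.tendsto 0).comp he).norm).const_mul c
    refine squeeze_zero_norm' ?_ hlim
    filter_upwards [hq] with k ⟨_, hk⟩
    have h0 : 0 < 2 / t k ^ 2 := div_pos two_pos (pow_pos (ht.1 k) 2)
    rw [hu_def, norm_smul, Real.norm_of_nonneg h0.le]
    refine (mul_le_mul_of_nonneg_left hk h0.le).trans_eq ?_
    have h1 : 0 < t k ^ 2 / 2 := div_pos (pow_pos (ht.1 k) 2) two_pos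
    rw [hFp, map_smul, norm_smul, Real.norm_of_nonneg h1.le]
    have := (ht.1 k).ne'
    field_simp
  have hqu : ∀ k, q k = x + t k • d + ((1 / 2 : ℝ) * t k ^ 2) • (h + u k) := fun k => by
    have h0 : t k ≠ 0 := (ht.1 k).ne'
    simp only [hu_def, hp_def]
    match_scalars <;> field_simp <;> ring
  have hqx : Tendsto q atTop (𝓝 x) := by
    have := ((ht.2.smul_const d).const_add x).add
      (((ht.2.pow 2).const_mul (1 / 2)).smul (hu.const_add h))
    simp only [zero_pow two_ne_zero, mul_zero, zero_smul, add_zero] at this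
    exact this.congr fun k => (hqu k).symm
  have hFq : Tendsto (fun k => F (q k) - F x) atTop (𝓝 0) := by
    simpa using ((hF.continuous.tendsto x).comp hqx).sub_const (F x)
  have hsw : Tendsto (fun k => (t k / 2) • w) atTop (𝓝 0) := by
    simpa using ht.half.2.smul_const w
  have hmem : ∀ᶠ k in atTop, q k ∈ feasibleSet F D := by
    filter_upwards [hq, hFq.eventually hloc, hsw.eventually hKloc] with k ⟨hk, _⟩ hk1 hk2
    rw [add_sub_cancel] at hk1
    -- `A d + (t/2) w` lies in the cone by the local description at `A d`; scaling by `t` and adding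
    -- the `Sᗮ`-error gives `F (q k) - F x`.
    refine hk1.2 ?_
    have h1 := hcone _ (ht.1 k) _ (hk2.2 (hKcone _ (ht.half.1 k) _ hh))
    have h2 := htrans _ h1 _ hk
    convert h2 using 1
    simp only [hy_def]
    abel
  classical
  -- For the finitely many bad indices the default value makes the point equal to `x`.
  refine ⟨fun k => if q k ∈ feasibleSet F D then h + u k else (2 / t k ^ 2) • -(t k • d),
    ?_, fun k => ?_⟩
  · have : Tendsto (fun k => h + u k) atTop (𝓝 h) := by simpa using hu.const_add h
    refine this.congr' ?_
    filter_upwards [hmem] with k hk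
    rw [if_pos hk]
  · beta_reduce
    split_ifs with hk
    · rwa [← hqu]
    · have h0 : t k ≠ 0 := (ht.1 k).ne'
      convert hd.1 using 1
      match_scalars <;> field_simp; ring

theorem innerTangentSet₂_subset_outerTangentSet₂ (X : Set (EuclideanSpace ℝ (Fin n)))
    (x d : EuclideanSpace ℝ (Fin n)) : innerTangentSet₂ X x d ⊆ outerTangentSet₂ X x d := by
  rintro h ⟨hd, hh⟩
  obtain ⟨v, hv, hX⟩ := hh _ downToZero_one_div
  exact ⟨hd, _, v, downToZero_one_div, hv, hX⟩

/-- Under LICQ the linearized second-order system has a solution. -/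
theorem exists_mem_tangentCone_tangentCone (hF : DifferentiableAt ℝ F x)
    (hD : ∀ i, IsPolyhedral (D i)) (hLICQ : LICQ F D x)
    (hd : d ∈ tangentCone (feasibleSet F D) x) (b : EuclideanSpace ℝ (Fin m)) :
    ∃ h, fderiv ℝ F x h + b ∈
      tangentCone (tangentCone (disjunctiveSet D) (F x)) (fderiv ℝ F x d) := by
  have hAd := fderiv_mem_tangentCone hF hd
  set S := ⨆ (i : Fin r) (_ : F x ∈ D i), Submodule.span ℝ (frechetNormalCone (D i) (F x))
  obtain ⟨C, -, hCeq, -, -, htrans⟩ := exists_tangentCone_pieces hD hd.1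
  rw [hCeq] at hAd ⊢
  have hsurj := range_orthogonalProjectionOnto_comp_eq_top (fderiv ℝ F x) S
    fun l hl hl0 => hLICQ l hl0 hl
  obtain ⟨h, hh⟩ := LinearMap.range_eq_top.1 hsurj (-S.orthogonalProjectionOnto b)
  have hperp : fderiv ℝ F x h + b ∈ Sᗮ := by
    rw [← Submodule.orthogonalProjectionOnto_eq_zero_iff, map_add]
    exact eq_neg_iff_add_eq_zero.1 hh
  -- Since `w ∈ Sᗮ`, the whole ray from `∇F(x)d` in direction `w` stays in the cone, so a constant
  -- sequence suffices.
  exact ⟨h, hAd, _, fun _ => fderiv ℝ F x h + b, downToZero_one_div, tendsto_const_nhds,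
    fun k => htrans _ hAd _ (Sᗮ.smul_mem _ hperp)⟩

end TangentSets

end MPDC

theorem mainTheorem6 {n m r : ℕ}
    (F : EuclideanSpace ℝ (Fin n) → EuclideanSpace ℝ (Fin m)) (hF : ContDiff ℝ 2 F)
    (D : Fin r → Set (EuclideanSpace ℝ (Fin m))) (hD : ∀ i, MPDC.IsPolyhedral (D i))
    (x : EuclideanSpace ℝ (Fin n)) (hx : x ∈ MPDC.feasibleSet F D)
    (hLICQ : MPDC.LICQ F D x)
    (d : EuclideanSpace ℝ (Fin n)) (hd : d ∈ MPDC.tangentCone (MPDC.feasibleSet F D) x) :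
    MPDC.outerTangentSet₂ (MPDC.feasibleSet F D) x d =
        {h | fderiv ℝ F x h + MPDC.secondDeriv F x d d ∈
          MPDC.tangentCone (MPDC.tangentCone (MPDC.disjunctiveSet D) (F x)) (fderiv ℝ F x d)} ∧
      (MPDC.outerTangentSet₂ (MPDC.feasibleSet F D) x d).Nonempty ∧
      MPDC.ParabolicallyDerivableAt (MPDC.feasibleSet F D) x d := by
  have hout := fun h => MPDC.mem_tangentCone_of_mem_outerTangentSet₂ (h := h) (d := d) (x := x)
    hF hD
  have hinn := fun h => MPDC.mem_innerTangentSet₂_of_mem_tangentCone (h := h) hF hD hLICQ hd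
  have hsub := MPDC.innerTangentSet₂_subset_outerTangentSet₂ (MPDC.feasibleSet F D) x d
  refine ⟨Set.Subset.antisymm (fun h hh => hout h hh) fun h hh => hsub (hinn h hh), ?_,
    Set.Subset.antisymm hsub fun h hh => hinn h (hout h hh)⟩
  obtain ⟨h, hh⟩ := MPDC.exists_mem_tangentCone_tangentCone
    (hF.differentiable (by norm_num) x) hD hLICQ hd (MPDC.secondDeriv F x d d)
  exact ⟨h, hsub (hinn h hh)⟩
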